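/- Let $\mathbb{F}$ be $\mathbb{R}$ or $\mathbb{C}$. Let $\boldsymbol{w}=(w_n)_{n=1}^\infty$ be a non-increasing weight, that is, a non-increasing sequence in $[0,\infty)$ with $w_1>0$, and put $s_m=\sum_{n=1}^m w_n$. Let $\mathbb{S}\subset\mathbb{F}^{\mathbb{N}}$ be a symmetric Banach space, that is, the space built from a rearrangement invariant Banach function norm $\|\cdot\|_{\mathbb{S}}$ (in the sense of Bennett and Sharpley) over $\mathbb{N}$ with the counting measure, and let $\Lambda_m=\|\sum_{n=1}^m e_n\|_{\mathbb{S}}$ be its fundamental function. Assume that $(s_m/\Lambda_m)_{m=1}^\infty$ is bounded. For $f=(a_n)_{n=1}^\infty\in\mathbb{F}^{\mathbb{N}}$ and $A\subset\mathbb{N}$ finite let $S_A(f)$ be the sequence that agrees with $f$ on $A$ and vanishes off $A$, and put \[ \|f\|_{\mathbb{S}[\boldsymbol{w}]}=\sup_{|A|<\infty}\frac{s_{|A|}}{\Lambda_{|A|}}\,\|S_A(f)\|_{\mathbb{S}}, \qquad \|f\|_{b_{\boldsymbol{w}}}=\sup_{(B,I)}\Big|\sum_{n\in I\setminus B} w_n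 a_n\Big|, \] where the term with $A=\emptyset$ is $0$ and the second supremum runs over all pairs of a finite set $B\subset\mathbb{N}$ and a finite integer interval $I\subset\mathbb{N}$ such that $I=\emptyset$ or $|B|<\min I$. Let $\mathbb{B}[\boldsymbol{w},\mathbb{S}]$ be the Banach space of all $f\in\mathbb{F}^{\mathbb{N}}$ with \[ \max\{\|f\|_{\mathbb{S}[\boldsymbol{w}]},\|f\|_{b_{\boldsymbol{w}}}\}<\infty, \] with this maximum as its norm, and let $\mathbb{B}_0[\boldsymbol{w},\mathbb{S}]$ be the closure in it of the finitely supported sequences. Then the Banach space $\mathbb{B}_0[\boldsymbol{w},\mathbb{S}]$ is not reflexive. -/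

import Mathlib

open scoped NNReal ENNReal Topology

namespace CondBasis

/-- A weight: a sequence in `[0, ∞)` whose first term is positive.  Sequences are indexed from `0`:
the index `n` stands for the coordinate `n + 1`. -/
structure Weight where
  toFun : ℕ → ℝ≥0
  pos_zero : 0 < toFun 0

/-- The primitive sequence `s m = w 0 + ... + w (m - 1)` (the sum of the first `m` terms). -/
def Weight.primitive (w : Weight) (m : ℕ) : ℝ≥0 := ∑ n ∈ Finset.range m, w.toFun n

/-- A rearrangement invariant Banach function norm over `ℕ` with the counting measure
(Bennett-Sharpley).  It represents the symmetric Banach space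
`{f : ℕ → 𝕜 | toFun (fun n => ‖f n‖ₑ) < ∞}`. -/
structure RINorm where
  toFun : (ℕ → ℝ≥0∞) → ℝ≥0∞
  eq_zero_iff : ∀ f, toFun f = 0 ↔ f = 0
  smul : ∀ (a : ℝ≥0) (f : ℕ → ℝ≥0∞), toFun (fun n => a * f n) = a * toFun f
  add_le : ∀ f g, toFun (f + g) ≤ toFun f + toFun g
  mono : ∀ f g, f ≤ g → toFun f ≤ toFun g
  fatou : ∀ F : ℕ → ℕ → ℝ≥0∞, Monotone F → toFun (⨆ k, F k) = ⨆ k, toFun (F k)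
  indicator_lt_top : ∀ E : Finset ℕ, toFun (Set.indicator (E : Set ℕ) 1) < ∞
  sum_le : ∀ E : Finset ℕ, ∃ C : ℝ≥0, ∀ f : ℕ → ℝ≥0∞, ∑ n ∈ E, f n ≤ C * toFun f
  /-- Sequences with the same distribution function have the same norm. -/
  rearrangement_invariant : ∀ f g : ℕ → ℝ≥0∞,
    (∀ t : ℝ≥0, {n | (t : ℝ≥0∞) < f n}.encard = {n | (t : ℝ≥0∞) < g n}.encard) →
      toFun f = toFun g

/-- The fundamental function: `Λ m` is the norm of the indicator of any set of `m` elements. -/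
noncomputable def RINorm.fundamental (S : RINorm) (m : ℕ) : ℝ≥0∞ :=
  S.toFun (Set.indicator (Finset.range m : Set ℕ) 1)

/-- The ratio `s m / Λ m` (it is `0` for `m = 0`). -/
noncomputable def ratio (w : Weight) (S : RINorm) (m : ℕ) : ℝ≥0∞ :=
  (w.primitive m : ℝ≥0∞) / S.fundamental m

section
variable (𝕜 : Type) [RCLike 𝕜]

/-- The gauge of `S[w]`: the supremum over finite sets `A` of `(s |A| / Λ |A|) ‖S_A f‖_S`, where
`S_A` is the coordinate projection. -/
noncomputable def gaugeSw (w : Weight) (S : RINorm) (f : ℕ → 𝕜) : ℝ≥0∞ :=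
  ⨆ A : Finset ℕ, ratio w S A.card * S.toFun (Set.indicator (A : Set ℕ) (fun n => ‖f n‖ₑ))

/-- The pairs `(B, I)` with `B` a finite set of coordinates and `I` a finite interval of coordinates
such that `I` is empty or `|B| < min I`.  (The index `n` stands for the coordinate `n + 1`.) -/
def admissible : Set (Finset ℕ × Finset ℕ) :=
  {p | (∃ a b, p.2 = Finset.Ico a b) ∧ ∀ n ∈ p.2, p.1.card < n + 1}

/-- The functional `T_{w,I,B}`, the sum of `w n * f n` over `n` in `I \ B`. -/
noncomputable def functionalT (w : Weight) (I B : Finset ℕ) (f : ℕ → 𝕜) : 𝕜 :=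
  ∑ n ∈ I \ B, ((w.toFun n : ℝ) : 𝕜) * f n

/-- The gauge of `b_w`. -/
noncomputable def gaugeB (w : Weight) (f : ℕ → 𝕜) : ℝ≥0∞ :=
  ⨆ p ∈ admissible, ‖functionalT 𝕜 w p.2 p.1 f‖ₑ

/-- The gauge of `B[w, S]`, the intersection of `S[w]` and `b_w`. -/
noncomputable def gauge (w : Weight) (S : RINorm) (f : ℕ → 𝕜) : ℝ≥0∞ :=
  max (gaugeSw 𝕜 w S f) (gaugeB 𝕜 w f)

variable {𝕜}

theorem functionalT_add (w : Weight) (I B : Finset ℕ) (f g : ℕ → 𝕜) :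
    functionalT 𝕜 w I B (f + g) = functionalT 𝕜 w I B f + functionalT 𝕜 w I B g := by
  simp [functionalT, mul_add, Finset.sum_add_distrib]

theorem functionalT_smul (w : Weight) (I B : Finset ℕ) (c : 𝕜) (f : ℕ → 𝕜) :
    functionalT 𝕜 w I B (c • f) = c * functionalT 𝕜 w I B f := by
  simp only [functionalT, Finset.mul_sum, Pi.smul_apply, smul_eq_mul]
  exact Finset.sum_congr rfl fun _ _ => by ring

theorem gauge_add_le (w : Weight) (S : RINorm) (f g : ℕ → 𝕜) :
    gauge 𝕜 w S (f + g) ≤ gauge 𝕜 w S f + gauge 𝕜 w S g := by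
  refine max_le (iSup_le fun A => ?_) (iSup₂_le fun p hp => ?_)
  · have h : S.toFun (Set.indicator (A : Set ℕ) (fun n => ‖(f + g) n‖ₑ)) ≤
        S.toFun (Set.indicator (A : Set ℕ) (fun n => ‖f n‖ₑ)) +
          S.toFun (Set.indicator (A : Set ℕ) (fun n => ‖g n‖ₑ)) := by
      refine le_trans (S.mono _ _ fun n => ?_) (S.add_le _ _)
      by_cases hn : n ∈ (A : Set ℕ)
      · simp only [Set.indicator_of_mem hn, Pi.add_apply]
        exact enorm_add_le _ _
      · simp [Set.indicator_of_notMem hn]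
    refine (mul_le_mul_right h _).trans ?_
    rw [mul_add]
    exact add_le_add
      ((le_iSup (fun A : Finset ℕ => ratio w S A.card *
        S.toFun (Set.indicator (A : Set ℕ) (fun n => ‖f n‖ₑ))) A).trans (le_max_left _ _))
      ((le_iSup (fun A : Finset ℕ => ratio w S A.card *
        S.toFun (Set.indicator (A : Set ℕ) (fun n => ‖g n‖ₑ))) A).trans (le_max_left _ _))
  · rw [functionalT_add]
    exact (enorm_add_le _ _).trans (add_le_add
      ((le_iSup₂ (f := fun p (_ : p ∈ admissible) => ‖functionalT 𝕜 w p.2 p.1 f‖ₑ) p hp).trans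
        (le_max_right _ _))
      ((le_iSup₂ (f := fun p (_ : p ∈ admissible) => ‖functionalT 𝕜 w p.2 p.1 g‖ₑ) p hp).trans
        (le_max_right _ _)))

theorem gauge_smul (w : Weight) (S : RINorm) (c : 𝕜) (f : ℕ → 𝕜) :
    gauge 𝕜 w S (c • f) = ‖c‖ₑ * gauge 𝕜 w S f := by
  have h1 : gaugeSw 𝕜 w S (c • f) = ‖c‖ₑ * gaugeSw 𝕜 w S f := by
    simp only [gaugeSw, ENNReal.mul_iSup]
    refine iSup_congr fun A => ?_
    have : Set.indicator (A : Set ℕ) (fun n => ‖(c • f) n‖ₑ) =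
        fun n => (‖c‖₊ : ℝ≥0∞) * Set.indicator (A : Set ℕ) (fun n => ‖f n‖ₑ) n := by
      ext n
      by_cases hn : n ∈ (A : Set ℕ)
      · simp only [Set.indicator_of_mem hn, Pi.smul_apply, smul_eq_mul, enorm_mul]
        rfl
      · simp [Set.indicator_of_notMem hn]
    rw [this, S.smul]
    change _ * (‖c‖ₑ * _) = _
    ring
  have h2 : gaugeB 𝕜 w (c • f) = ‖c‖ₑ * gaugeB 𝕜 w f := by
    simp only [gaugeB, ENNReal.mul_iSup, functionalT_smul, enorm_mul]
  rw [gauge, gauge, h1, h2, mul_max]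

theorem gauge_zero (w : Weight) (S : RINorm) : gauge 𝕜 w S (0 : ℕ → 𝕜) = 0 := by
  have := gauge_smul w S (0 : 𝕜) 0
  simpa using this

/-- Coordinates are controlled by the gauge. -/
theorem exists_coord_le (w : Weight) (S : RINorm) (n : ℕ) :
    ∃ C : ℝ≥0, ∀ f : ℕ → 𝕜, ‖f n‖ₑ ≤ C * gauge 𝕜 w S f := by
  obtain ⟨C, hC⟩ := S.sum_le {n}
  have hr0 : ratio w S 1 ≠ 0 := by
    refine (ENNReal.div_pos ?_ (S.indicator_lt_top _).ne).ne'
    simpa [Weight.primitive] using w.pos_zero.ne'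
  have hrt : ratio w S 1 ≠ ∞ := by
    refine ENNReal.div_ne_top ENNReal.coe_ne_top ?_
    intro h
    have := congrFun ((S.eq_zero_iff _).1 h) 0
    simp at this
  refine ⟨C * (ratio w S 1)⁻¹.toNNReal, fun f => ?_⟩
  have h1 := hC (Set.indicator (({n} : Finset ℕ) : Set ℕ) (fun n => ‖f n‖ₑ))
  have h2 : ratio w S 1 * S.toFun (Set.indicator (({n} : Finset ℕ) : Set ℕ)
      (fun n => ‖f n‖ₑ)) ≤ gauge 𝕜 w S f :=
    (le_iSup (fun A : Finset ℕ => ratio w S A.card *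
        S.toFun (Set.indicator (A : Set ℕ) (fun n => ‖f n‖ₑ))) {n}).trans (le_max_left _ _)
  have h3 : S.toFun (Set.indicator (({n} : Finset ℕ) : Set ℕ) (fun n => ‖f n‖ₑ)) ≤
      (ratio w S 1)⁻¹ * gauge 𝕜 w S f := by
    rw [mul_comm, ← div_eq_mul_inv, ENNReal.le_div_iff_mul_le (Or.inl hr0) (Or.inl hrt), mul_comm]
    exact h2
  have h4 : ‖f n‖ₑ ≤ C * S.toFun (Set.indicator (({n} : Finset ℕ) : Set ℕ)
      (fun n => ‖f n‖ₑ)) := by simpa using h1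
  rw [ENNReal.coe_mul, ENNReal.coe_toNNReal (ENNReal.inv_ne_top.2 hr0), mul_assoc]
  exact h4.trans (mul_le_mul_right h3 _)

/-- The gauge is lower semicontinuous for coordinatewise convergence. -/
theorem gauge_le_of_tendsto (w : Weight) (S : RINorm) (F : ℕ → ℕ → 𝕜) (f : ℕ → 𝕜) (r : ℝ≥0∞)
    (hF : ∀ n, Filter.Tendsto (fun k => F k n) Filter.atTop (𝓝 (f n)))
    (hr : ∀ k, gauge 𝕜 w S (F k) ≤ r) : gauge 𝕜 w S f ≤ r := by
  refine max_le (iSup_le fun A => ?_) (iSup₂_le fun p hp => ?_)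
  · let G : ℕ → ℕ → ℝ≥0∞ := fun k n =>
      ⨅ j ≥ k, Set.indicator (A : Set ℕ) (fun n => ‖F j n‖ₑ) n
    have hG : Monotone G := fun k l hkl n =>
      le_iInf₂ fun j hj => iInf₂_le j (hkl.trans hj)
    have hlim : Set.indicator (A : Set ℕ) (fun n => ‖f n‖ₑ) = ⨆ k, G k := by
      ext n
      have ht : Filter.Tendsto (fun k => Set.indicator (A : Set ℕ) (fun n => ‖F k n‖ₑ) n)
          Filter.atTop (𝓝 (Set.indicator (A : Set ℕ) (fun n => ‖f n‖ₑ) n)) := by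
        by_cases hn : n ∈ (A : Set ℕ)
        · simp only [Set.indicator_of_mem hn]
          exact (hF n).enorm
        · simp [Set.indicator_of_notMem hn]
      rw [← ht.liminf_eq, Filter.liminf_eq_iSup_iInf_of_nat, iSup_apply]
    rw [hlim, S.fatou G hG, ENNReal.mul_iSup]
    refine iSup_le fun k => le_trans ?_ (hr k)
    refine le_trans (mul_le_mul_right (S.mono _ _ fun n => iInf₂_le k le_rfl) _) ?_
    exact (le_iSup (fun A : Finset ℕ => ratio w S A.card *
        S.toFun (Set.indicator (A : Set ℕ) (fun n => ‖F k n‖ₑ))) A).trans (le_max_left _ _)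
  · have ht : Filter.Tendsto (fun k => ‖functionalT 𝕜 w p.2 p.1 (F k)‖ₑ) Filter.atTop
        (𝓝 ‖functionalT 𝕜 w p.2 p.1 f‖ₑ) :=
      (tendsto_finsetSum _ fun n _ => (hF n).const_mul _).enorm
    refine le_of_tendsto' ht fun k => le_trans ?_ (hr k)
    exact (le_iSup₂ (f := fun p (_ : p ∈ admissible) => ‖functionalT 𝕜 w p.2 p.1 (F k)‖ₑ)
      p hp).trans (le_max_right _ _)

variable (𝕜)

/-- The linear space of the sequences with finite gauge. -/
noncomputable def submoduleB (w : Weight) (S : RINorm) : Submodule 𝕜 (ℕ → 𝕜) where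
  carrier := {f | gauge 𝕜 w S f < ∞}
  add_mem' {f g} hf hg := (gauge_add_le w S f g).trans_lt (ENNReal.add_lt_top.2 ⟨hf, hg⟩)
  zero_mem' := by simp [gauge_zero]
  smul_mem' c f hf := by
    change gauge 𝕜 w S (c • f) < ∞
    rw [gauge_smul]
    exact ENNReal.mul_lt_top enorm_lt_top hf

/-- The space `B[w, S]`, a type of its own so that it carries the topology of its norm and not that
of coordinatewise convergence. -/
def BSpace (w : Weight) (S : RINorm) : Type := submoduleB 𝕜 w S

noncomputable instance (w : Weight) (S : RINorm) : AddCommGroup (BSpace 𝕜 w S) :=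
  inferInstanceAs (AddCommGroup (submoduleB 𝕜 w S))

noncomputable instance (w : Weight) (S : RINorm) : Module 𝕜 (BSpace 𝕜 w S) :=
  inferInstanceAs (Module 𝕜 (submoduleB 𝕜 w S))

variable {𝕜}

/-- The sequence underlying an element of `B[w, S]`. -/
noncomputable def BSpace.seq {w : Weight} {S : RINorm} : BSpace 𝕜 w S →ₗ[𝕜] (ℕ → 𝕜) :=
  (submoduleB 𝕜 w S).subtype

theorem BSpace.gauge_lt_top {w : Weight} {S : RINorm} (f : BSpace 𝕜 w S) :
    gauge 𝕜 w S f.seq < ∞ := f.2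

/-- The norm of `B[w, S]`: the maximum of the norms of `S[w]` and `b_w`. -/
noncomputable instance (w : Weight) (S : RINorm) : Norm (BSpace 𝕜 w S) :=
  ⟨fun f => (gauge 𝕜 w S f.seq).toReal⟩

theorem BSpace.norm_def {w : Weight} {S : RINorm} (f : BSpace 𝕜 w S) :
    ‖f‖ = (gauge 𝕜 w S f.seq).toReal := rfl

theorem BSpace.core (w : Weight) (S : RINorm) : NormedSpace.Core 𝕜 (BSpace 𝕜 w S) where
  norm_nonneg _ := ENNReal.toReal_nonneg
  norm_smul c f := by
    rw [norm_def, norm_def, map_smul, gauge_smul, ENNReal.toReal_mul, toReal_enorm]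
  norm_triangle f g := by
    rw [norm_def, norm_def, norm_def, map_add,
      ← ENNReal.toReal_add f.gauge_lt_top.ne g.gauge_lt_top.ne]
    exact ENNReal.toReal_mono (ENNReal.add_ne_top.2 ⟨f.gauge_lt_top.ne, g.gauge_lt_top.ne⟩)
      (gauge_add_le w S _ _)
  norm_eq_zero_iff f := by
    constructor
    · intro h
      rw [norm_def, ENNReal.toReal_eq_zero_iff, or_iff_left f.gauge_lt_top.ne] at h
      refine Subtype.ext (funext fun n => ?_)
      obtain ⟨C, hC⟩ := exists_coord_le (𝕜 := 𝕜) w S n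
      have := hC f.seq
      rw [h, mul_zero, nonpos_iff_eq_zero, enorm_eq_zero] at this
      exact this
    · rintro rfl
      rw [norm_def, map_zero, gauge_zero, ENNReal.toReal_zero]

noncomputable instance (w : Weight) (S : RINorm) : NormedAddCommGroup (BSpace 𝕜 w S) :=
  NormedAddCommGroup.ofCore (BSpace.core w S)

noncomputable instance (w : Weight) (S : RINorm) : NormedSpace 𝕜 (BSpace 𝕜 w S) :=
  NormedSpace.ofCore (BSpace.core w S)

theorem BSpace.exists_coord_le (w : Weight) (S : RINorm) (n : ℕ) :
    ∃ C : ℝ≥0, ∀ f : BSpace 𝕜 w S, ‖f.seq n‖ ≤ C * ‖f‖ := by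
  obtain ⟨C, hC⟩ := CondBasis.exists_coord_le (𝕜 := 𝕜) w S n
  refine ⟨C, fun f => ?_⟩
  have := ENNReal.toReal_mono (ENNReal.mul_ne_top ENNReal.coe_ne_top f.gauge_lt_top.ne) (hC f.seq)
  rwa [toReal_enorm, ENNReal.toReal_mul, ENNReal.coe_toReal, ← norm_def] at this

/-- `B[w, S]` is a Banach space. -/
instance (w : Weight) (S : RINorm) : CompleteSpace (BSpace 𝕜 w S) := by
  refine Metric.complete_of_cauchySeq_tendsto fun u hu => ?_
  have hc : ∀ n, ∃ a : 𝕜, Filter.Tendsto (fun k => (u k).seq n) Filter.atTop (𝓝 a) := by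
    intro n
    obtain ⟨C, hC⟩ := BSpace.exists_coord_le (𝕜 := 𝕜) w S n
    refine cauchySeq_tendsto_of_complete ?_
    refine LipschitzWith.cauchySeq_comp (f := fun g : BSpace 𝕜 w S => g.seq n) (K := C) ?_ hu
    refine LipschitzWith.of_dist_le_mul fun x y => ?_
    rw [dist_eq_norm, dist_eq_norm]
    simpa using hC (x - y)
  choose a ha using hc
  have key : ∀ ε : ℝ, 0 < ε → ∃ N, ∀ k ≥ N,
      gauge 𝕜 w S (a - (u k).seq) ≤ ENNReal.ofReal ε := by
    intro ε hε
    obtain ⟨N, hN⟩ := Metric.cauchySeq_iff.1 hu ε hε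
    refine ⟨N, fun k hk => ?_⟩
    refine gauge_le_of_tendsto w S (fun j => (u (j + N) - u k).seq) _ _ (fun n => ?_) fun j => ?_
    · have := ((Filter.tendsto_add_atTop_iff_nat N).2 (ha n)).sub_const ((u k).seq n)
      simpa using this
    · have := hN (j + N) (Nat.le_add_left _ _) k hk
      rw [dist_eq_norm, BSpace.norm_def] at this
      exact (ENNReal.le_ofReal_iff_toReal_le (BSpace.gauge_lt_top _).ne hε.le).2 this.le
  have hmem : gauge 𝕜 w S a < ∞ := by
    obtain ⟨N, hN⟩ := key 1 one_pos
    have h := gauge_add_le w S (a - (u N).seq) (u N).seq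
    rw [sub_add_cancel] at h
    exact h.trans_lt (ENNReal.add_lt_top.2
      ⟨(hN N le_rfl).trans_lt ENNReal.ofReal_lt_top, (u N).gauge_lt_top⟩)
  let l : BSpace 𝕜 w S := ⟨a, hmem⟩
  refine ⟨l, Metric.tendsto_atTop.2 fun ε hε => ?_⟩
  obtain ⟨N, hN⟩ := key (ε / 2) (half_pos hε)
  refine ⟨N, fun k hk => ?_⟩
  rw [dist_comm, dist_eq_norm, BSpace.norm_def, map_sub]
  exact (ENNReal.toReal_le_of_le_ofReal (half_pos hε).le (hN k hk)).trans_lt (half_lt_self hε)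

variable (𝕜)

/-- The finitely supported sequences in `B[w, S]`. -/
noncomputable def finSupp (w : Weight) (S : RINorm) : Submodule 𝕜 (BSpace 𝕜 w S) where
  carrier := {f | (Function.support f.seq).Finite}
  add_mem' {f g} hf hg := (hf.union hg).subset (by
    rw [map_add]; exact Function.support_add _ _)
  zero_mem' := by simp
  smul_mem' c f hf := hf.subset (by
    rw [map_smul]; exact Function.support_const_smul_subset _ _)

/-- The separable part `B₀[w, S]`: the closure of the finitely supported sequences in `B[w, S]`,
a Banach space with the norm of `B[w, S]`. -/
noncomputable abbrev B0Space (w : Weight) (S : RINorm) : Submodule 𝕜 (BSpace 𝕜 w S) :=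
  (finSupp 𝕜 w S).topologicalClosure

end

/-- A normed space is reflexive if the canonical map into its bidual is onto. -/
def IsReflexive (𝕜 : Type) [RCLike 𝕜] (E : Type) [NormedAddCommGroup E] [NormedSpace 𝕜 E] : Prop :=
  Function.Surjective (NormedSpace.inclusionInDoubleDual 𝕜 E)

end CondBasis

/-! In a reflexive space a bounded sequence has a weak limit along any ultrafilter. In each of two
cases a bounded sequence of multiples of indicators admits no such limit. If `w.primitive` is
bounded, the indicators of initial segments are bounded. A weak limit would have all coordinates
`1`, but elements of `B0Space` have arbitrarily small coordinates. If it is unbounded, `T f = ∑ w n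
* f n`, bounded thanks to the gauge `gaugeB`, detects normalized blocks: suitable indicators of
intervals `[k, k + m)`, divided by `w.primitive m`, have norm at most `2` and `‖T‖` at least `1/2`
on them. Their coordinates tend to `0`, so the weak limit is `0`, contradicting the continuity of
`T`. Both norm bounds come from `gauge_indicator_le`; the second also needs
`exists_ratio_le_two_mul`. -/

namespace CondBasis

/-! ### Weak limits along ultrafilters. -/

/-- A pointwise bounded family of linear functionals has a pointwise limit along an ultrafilter. -/
theorem exists_functional_tendsto {𝕜 : Type} [RCLike 𝕜] {E : Type} [NormedAddCommGroup E]
    [NormedSpace 𝕜 E] {ι : Type} (U : Ultrafilter ι) (φ : ι → E →ₗ[𝕜] 𝕜) (C : ℝ)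
    (hφ : ∀ i x, ‖φ i x‖ ≤ C * ‖x‖) :
    ∃ ψ : StrongDual 𝕜 E, ∀ x, Filter.Tendsto (fun i => φ i x) U (𝓝 (ψ x)) := by
  have h : ∀ x, ∃ a : 𝕜, ‖a‖ ≤ C * ‖x‖ ∧ Filter.Tendsto (fun i => φ i x) U (𝓝 a) := by
    intro x
    obtain ⟨a, ha, hta⟩ := (isCompact_closedBall (0 : 𝕜) (C * ‖x‖)).ultrafilter_le_nhds
      (U.map fun i => φ i x) (by
        rw [Filter.le_principal_iff]
        exact Filter.mem_map.2 (Filter.Eventually.of_forall fun i => by simpa using hφ i x))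
    exact ⟨a, by simpa using ha, hta⟩
  choose L hLb hL using h
  let ℓ : E →ₗ[𝕜] 𝕜 :=
    { toFun := L
      map_add' := fun x y => tendsto_nhds_unique (hL (x + y)) (by
        simpa using (hL x).add (hL y))
      map_smul' := fun c x => tendsto_nhds_unique (hL (c • x)) (by
        simpa using (hL x).const_mul c) }
  exact ⟨ℓ.mkContinuous C hLb, hL⟩

/-- In a reflexive space, bounded families have weak limits along ultrafilters. -/
theorem IsReflexive.exists_weak_limit {𝕜 : Type} [RCLike 𝕜] {E : Type} [NormedAddCommGroup E]
    [NormedSpace 𝕜 E] (hE : IsReflexive 𝕜 E) {ι : Type} (U : Ultrafilter ι) (x : ι → E) (C : ℝ)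
    (hx : ∀ i, ‖x i‖ ≤ C) :
    ∃ g : E, ∀ φ : StrongDual 𝕜 E, Filter.Tendsto (fun i => φ (x i)) U (𝓝 (φ g)) := by
  -- The limit is taken in the bidual, where it always exists; reflexivity brings it back to the
  -- space.
  obtain ⟨ψ, hψ⟩ := exists_functional_tendsto U
    (fun i => (NormedSpace.inclusionInDoubleDual 𝕜 E (x i)).toLinearMap) C (fun i φ => by
      have h1 : ‖φ (x i)‖ ≤ ‖φ‖ * ‖x i‖ := φ.le_opNorm _
      have h2 : ‖φ‖ * ‖x i‖ ≤ ‖φ‖ * C := mul_le_mul_of_nonneg_left (hx i) (norm_nonneg _)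
      simpa [mul_comm C] using h1.trans h2)
  obtain ⟨g, rfl⟩ := hE ψ
  exact ⟨g, fun φ => by simpa using hψ φ⟩

/-! ### The fundamental function and the partial sums of the weight. -/

theorem RINorm.indicator_eq_fundamental (S : RINorm) (E : Finset ℕ) :
    S.toFun (Set.indicator (E : Set ℕ) 1) = S.fundamental E.card := by
  refine S.rearrangement_invariant _ _ fun t => ?_
  have key : ∀ F : Finset ℕ, {n | (t : ℝ≥0∞) < Set.indicator (F : Set ℕ) 1 n} =
      if (t : ℝ≥0∞) < 1 then (F : Set ℕ) else ∅ := by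
    intro F
    ext n
    by_cases hn : n ∈ F <;> by_cases ht : (t : ℝ≥0∞) < 1 <;> simp [hn, ht]
  rw [key, key]
  split_ifs
  · rw [Set.encard_coe_eq_coe_finsetCard, Set.encard_coe_eq_coe_finsetCard, Finset.card_range]
  · rfl

theorem RINorm.fundamental_mono (S : RINorm) : Monotone S.fundamental := fun m n h =>
  S.mono _ _ (Set.indicator_le_indicator_of_subset (by simpa using h) (fun _ => zero_le))

theorem RINorm.fundamental_ne_top (S : RINorm) (m : ℕ) : S.fundamental m ≠ ∞ :=
  (S.indicator_lt_top _).ne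

theorem RINorm.fundamental_ne_zero (S : RINorm) {m : ℕ} (hm : m ≠ 0) : S.fundamental m ≠ 0 := by
  intro h
  have := congrFun ((S.eq_zero_iff _).1 h) 0
  simp [hm, Nat.pos_iff_ne_zero] at this

theorem ratio_mul_fundamental (w : Weight) (S : RINorm) (m : ℕ) :
    ratio w S m * S.fundamental m = w.primitive m := by
  rcases eq_or_ne m 0 with rfl | hm
  · simp [ratio, Weight.primitive]
  · exact ENNReal.div_mul_cancel (S.fundamental_ne_zero hm) (S.fundamental_ne_top m)

theorem Weight.primitive_mono (w : Weight) : Monotone w.primitive := fun _ _ h =>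
  Finset.sum_le_sum_of_subset (Finset.range_mono h)

theorem Weight.primitive_pos (w : Weight) {m : ℕ} (hm : m ≠ 0) : 0 < w.primitive m :=
  lt_of_lt_of_le (by simpa [Weight.primitive] using w.pos_zero)
    (w.primitive_mono (Nat.one_le_iff_ne_zero.2 hm))

/-- Removing the maximum `a` of a set leaves at most `a` elements below it, so `w a` is at most the
last term of the primitive sum. -/
theorem Weight.sum_le_primitive_card (w : Weight) (hw : Antitone w.toFun) (E : Finset ℕ) :
    ∑ n ∈ E, w.toFun n ≤ w.primitive E.card := by
  induction E using Finset.induction_on_max with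
  | empty => simp
  | insert a E ha ih =>
    have haE : a ∉ E := fun h => (ha a h).false
    have hcard : E.card ≤ a := by
      simpa using Finset.card_le_card (fun x hx => Finset.mem_range.2 (ha x hx) : E ⊆ Finset.range a)
    rw [Finset.sum_insert haE, Finset.card_insert_of_notMem haE, Weight.primitive,
      Finset.sum_range_succ, add_comm]
    exact add_le_add ih (hw hcard)

section
variable {𝕜 : Type} [RCLike 𝕜]

/-! ### Norms of indicators. -/

/-- Only `A ∩ E` contributes. Sets `A` with at least `E.card` elements fall under `hK`; a smaller
`A` gives at most `w.primitive A.card`, which is dominated by the case `j = E.card`. -/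
theorem gaugeSw_indicator_le (w : Weight) (S : RINorm) (E : Finset ℕ) (K : ℝ≥0∞)
    (hK : ∀ j, E.card ≤ j → ratio w S j * S.fundamental E.card ≤ K) :
    gaugeSw 𝕜 w S (Set.indicator (E : Set ℕ) 1) ≤ K := by
  refine iSup_le fun A => ?_
  have h : Set.indicator (A : Set ℕ)
      (fun n => ‖Set.indicator (E : Set ℕ) (1 : ℕ → 𝕜) n‖ₑ) =
      Set.indicator ((A ∩ E : Finset ℕ) : Set ℕ) 1 := by
    ext n
    by_cases hA : n ∈ A <;> by_cases hE : n ∈ E <;> simp [hA, hE]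
  rw [h, S.indicator_eq_fundamental]
  rcases le_total E.card A.card with hj | hj
  · refine le_trans ?_ (hK _ hj)
    gcongr
    exact S.fundamental_mono (Finset.card_le_card Finset.inter_subset_right)
  · calc ratio w S A.card * S.fundamental (A ∩ E).card
        ≤ ratio w S A.card * S.fundamental A.card := by
          gcongr
          exact S.fundamental_mono (Finset.card_le_card Finset.inter_subset_left)
      _ = w.primitive A.card := ratio_mul_fundamental w S _
      _ ≤ w.primitive E.card := by exact_mod_cast w.primitive_mono hj
      _ = ratio w S E.card * S.fundamental E.card := (ratio_mul_fundamental w S _).symm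
      _ ≤ K := hK _ le_rfl

theorem functionalT_indicator (w : Weight) (I B E : Finset ℕ) :
    functionalT 𝕜 w I B (Set.indicator (E : Set ℕ) 1) =
      (((∑ n ∈ (I \ B) ∩ E, w.toFun n : ℝ≥0) : ℝ) : 𝕜) := by
  simp [functionalT, Set.indicator_apply, Finset.sum_ite_mem]

theorem gaugeB_indicator_le (w : Weight) (hw : Antitone w.toFun) (E : Finset ℕ) :
    gaugeB 𝕜 w (Set.indicator (E : Set ℕ) 1) ≤ w.primitive E.card := by
  refine iSup₂_le fun p _ => ?_
  rw [functionalT_indicator, enorm_le_coe, ← NNReal.coe_le_coe, coe_nnnorm,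
    RCLike.norm_of_nonneg (NNReal.coe_nonneg _), NNReal.coe_le_coe]
  exact (Finset.sum_le_sum_of_subset Finset.inter_subset_right).trans
    (w.sum_le_primitive_card hw E)

theorem gauge_indicator_le (w : Weight) (hw : Antitone w.toFun) (S : RINorm) (E : Finset ℕ)
    (K : ℝ≥0∞) (hK : ∀ j, E.card ≤ j → ratio w S j * S.fundamental E.card ≤ K) :
    gauge 𝕜 w S (Set.indicator (E : Set ℕ) 1) ≤ K :=
  max_le (gaugeSw_indicator_le w S E K hK) ((gaugeB_indicator_le w hw E).trans
    (by rw [← ratio_mul_fundamental w S]; exact hK _ le_rfl))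

/-! ### Functionals on the space and decay of coordinates. -/

/-- The coordinates are uniformly bounded. -/
theorem weight_mul_coord_le_gauge (w : Weight) (S : RINorm) (f : ℕ → 𝕜) (n : ℕ) :
    (w.toFun 0 : ℝ≥0∞) * ‖f n‖ₑ ≤ gauge 𝕜 w S f := by
  have h1 : Set.indicator (({n} : Finset ℕ) : Set ℕ) (fun n => ‖f n‖ₑ) =
      fun k => (‖f n‖₊ : ℝ≥0∞) * Set.indicator (({n} : Finset ℕ) : Set ℕ) 1 k := by
    ext k
    by_cases hk : k = n
    · subst hk; simp [enorm_eq_nnnorm]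
    · simp [hk]
  have h2 : ratio w S 1 * S.toFun (Set.indicator (({n} : Finset ℕ) : Set ℕ)
      (fun n => ‖f n‖ₑ)) ≤ gauge 𝕜 w S f :=
    (le_iSup (fun A : Finset ℕ => ratio w S A.card *
        S.toFun (Set.indicator (A : Set ℕ) (fun n => ‖f n‖ₑ))) {n}).trans (le_max_left _ _)
  rw [h1, S.smul, S.indicator_eq_fundamental, Finset.card_singleton, mul_left_comm,
    ratio_mul_fundamental, mul_comm] at h2
  simpa [Weight.primitive, enorm_eq_nnnorm] using h2

theorem weight_mul_norm_coord_le (w : Weight) (S : RINorm) (f : BSpace 𝕜 w S) (n : ℕ) :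
    (w.toFun 0 : ℝ) * ‖f.seq n‖ ≤ ‖f‖ := by
  have := ENNReal.toReal_mono f.gauge_lt_top.ne (weight_mul_coord_le_gauge w S f.seq n)
  simpa [ENNReal.toReal_mul, BSpace.norm_def] using this

/-- With `B = ∅` every initial segment is an admissible interval. The bound is uniform in `N`, which
is what lets the partial sums have a bounded limit functional. -/
theorem norm_functionalT_range_le (w : Weight) (S : RINorm) (N : ℕ) (f : BSpace 𝕜 w S) :
    ‖functionalT 𝕜 w (Finset.range N) ∅ f.seq‖ ≤ ‖f‖ := by
  have h : ‖functionalT 𝕜 w (Finset.range N) ∅ f.seq‖ₑ ≤ gauge 𝕜 w S f.seq :=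
    (le_iSup₂ (f := fun p (_ : p ∈ admissible) => ‖functionalT 𝕜 w p.2 p.1 f.seq‖ₑ)
      (∅, Finset.range N) ⟨⟨0, N, by simp⟩, by simp⟩).trans (le_max_right _ _)
  have := ENNReal.toReal_mono f.gauge_lt_top.ne h
  simpa [BSpace.norm_def] using this

variable (𝕜)

/-- The `n`-th coordinate functional on `B₀[w, S]`. -/
theorem exists_coord_functional (w : Weight) (S : RINorm) (n : ℕ) :
    ∃ φ : StrongDual 𝕜 (B0Space 𝕜 w S), ∀ f, φ f = BSpace.seq (f : BSpace 𝕜 w S) n := by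
  obtain ⟨C, hC⟩ := BSpace.exists_coord_le (𝕜 := 𝕜) w S n
  exact ⟨(LinearMap.proj n ∘ₗ BSpace.seq ∘ₗ (B0Space 𝕜 w S).subtype).mkContinuous C
    fun f => hC f, fun f => rfl⟩

/-- The functional `f ↦ ∑ n, w n * f n` on `B₀[w, S]`, as a limit of its partial sums along an
ultrafilter. -/
theorem exists_weight_functional (w : Weight) (S : RINorm) (U : Ultrafilter ℕ) :
    ∃ T : StrongDual 𝕜 (B0Space 𝕜 w S), ∀ f : B0Space 𝕜 w S, Filter.Tendsto
      (fun N => functionalT 𝕜 w (Finset.range N) ∅ (BSpace.seq (f : BSpace 𝕜 w S))) U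
        (𝓝 (T f)) :=
  exists_functional_tendsto U
    (fun N => (
      { toFun := functionalT 𝕜 w (Finset.range N) ∅
        map_add' := functionalT_add w _ _
        map_smul' := functionalT_smul w _ _ } : (ℕ → 𝕜) →ₗ[𝕜] 𝕜) ∘ₗ BSpace.seq ∘ₗ
          (B0Space 𝕜 w S).subtype) 1
    fun N f => by simpa using norm_functionalT_range_le w S N (f : BSpace 𝕜 w S)

variable {𝕜}

/-- A finitely supported sequence of gauge at most `K` is an element of `B₀[w, S]`. -/
theorem exists_B0Space_of_gauge_le (w : Weight) (S : RINorm) (f : ℕ → 𝕜)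
    (hf : (Function.support f).Finite) (K : ℝ≥0) (hK : gauge 𝕜 w S f ≤ K) :
    ∃ x : B0Space 𝕜 w S, BSpace.seq (x : BSpace 𝕜 w S) = f ∧ ‖x‖ ≤ K :=
  ⟨⟨(⟨f, hK.trans_lt ENNReal.coe_lt_top⟩ : submoduleB 𝕜 w S),
    (finSupp 𝕜 w S).le_topologicalClosure hf⟩, rfl,
    ENNReal.toReal_le_of_le_ofReal K.coe_nonneg (by rw [ENNReal.ofReal_coe_nnreal]; exact hK)⟩

/-- The elements of `B₀[w, S]` have arbitrarily small coordinates. -/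
theorem exists_norm_coord_lt (w : Weight) (S : RINorm) (g : B0Space 𝕜 w S) :
    ∃ n, ‖BSpace.seq (g : BSpace 𝕜 w S) n‖ < 1 := by
  have hw0 : (0 : ℝ) < w.toFun 0 := w.pos_zero
  -- The radius `w 0` is the constant of the uniform coordinate bound, so off the support of `h` the
  -- coordinates of `g` are below `1`.
  obtain ⟨h, hh, hgh⟩ := Metric.mem_closure_iff.1 g.2 _ hw0
  have hfin : (Function.support h.seq).Finite := hh
  obtain ⟨n, hn⟩ := hfin.exists_notMem
  refine ⟨n, ?_⟩
  have h1 := weight_mul_norm_coord_le w S ((g : BSpace 𝕜 w S) - h) n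
  rw [dist_eq_norm] at hgh
  rw [map_sub, Pi.sub_apply, Function.notMem_support.1 hn, sub_zero] at h1
  exact lt_of_mul_lt_mul_left (by linarith) hw0.le

/-! ### The two cases: bounded and unbounded partial sums of the weight. -/

theorem not_isReflexive_of_primitive_bounded (w : Weight) (hw : Antitone w.toFun) (S : RINorm)
    (K : ℝ≥0) (hK : ∀ m, w.primitive m ≤ K) : ¬ IsReflexive 𝕜 (B0Space 𝕜 w S) := by
  intro hR
  have hx : ∀ k : ℕ, ∃ x : B0Space 𝕜 w S, BSpace.seq (x : BSpace 𝕜 w S) =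
      Set.indicator (Finset.range k : Set ℕ) 1 ∧ ‖x‖ ≤ K := fun k => by
    refine exists_B0Space_of_gauge_le w S _
      ((Finset.range k).finite_toSet.subset Set.support_indicator_subset) K
      (gauge_indicator_le w hw S _ _ fun j hj => ?_)
    calc ratio w S j * S.fundamental (Finset.range k).card
        ≤ ratio w S j * S.fundamental j := by gcongr; exact S.fundamental_mono hj
      _ = w.primitive j := ratio_mul_fundamental w S j
      _ ≤ K := by exact_mod_cast hK j
  choose x hxs hxb using hx
  obtain ⟨g, hg⟩ := hR.exists_weak_limit (Filter.hyperfilter ℕ) x K hxb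
  obtain ⟨n, hn⟩ := exists_norm_coord_lt w S g
  obtain ⟨φ, hφ⟩ := exists_coord_functional 𝕜 w S n
  -- The `n`-th coordinate of `x k` is `1` as soon as `k > n`.
  have h1 := hg φ
  have h2 : Filter.Tendsto (fun k => φ (x k)) (Filter.hyperfilter ℕ : Filter ℕ) (𝓝 1) := by
    refine tendsto_const_nhds.congr' (Filter.Eventually.filter_mono
      (Nat.hyperfilter_le_atTop) ?_)
    filter_upwards [Filter.eventually_gt_atTop n] with k hk
    simp [hφ, hxs, hk]
  have h3 := tendsto_nhds_unique h1 h2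
  rw [hφ] at h3
  simp [h3] at hn

/-- Beyond any `N` there is an `m` such that the ratio does not exceed twice its value at `m` from
`m` on. -/
theorem exists_ratio_le_two_mul (w : Weight) (S : RINorm)
    (hbdd : ∃ C : ℝ≥0, ∀ m : ℕ, ratio w S m ≤ C) (N : ℕ) :
    ∃ m, N < m ∧ ∀ j, m ≤ j → ratio w S j ≤ 2 * ratio w S m := by
  obtain ⟨C, hC⟩ := hbdd
  -- The tail supremum is positive and, by `hbdd`, finite; hence some ratio in the tail exceeds half
  -- of it.
  set R : ℝ≥0∞ := ⨆ j ≥ N + 1, ratio w S j with hRdef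
  have hle : ∀ j ≥ N + 1, ratio w S j ≤ R := fun j hj =>
    le_iSup₂ (f := fun j (_ : j ≥ N + 1) => ratio w S j) j hj
  have hRt : R ≠ ∞ := ((iSup₂_le fun j _ => hC j : R ≤ C).trans_lt ENNReal.coe_lt_top).ne
  have hR0 : R ≠ 0 := by
    refine (lt_of_lt_of_le ?_ (hle (N + 1) le_rfl)).ne'
    exact ENNReal.div_pos (by simpa using (w.primitive_pos N.succ_ne_zero).ne')
      (S.fundamental_ne_top _)
  have hhalf : R / 2 < R := ENNReal.half_lt_self hR0 hRt
  obtain ⟨m, hm⟩ := lt_iSup_iff.1 hhalf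
  obtain ⟨hNm, hm⟩ := lt_iSup_iff.1 hm
  refine ⟨m, hNm, fun j hj => (hle j (hNm.trans hj)).trans ?_⟩
  rw [mul_comm]
  exact (ENNReal.div_le_iff two_ne_zero ENNReal.ofNat_ne_top).1 hm.le

theorem not_isReflexive_of_primitive_unbounded (w : Weight) (hw : Antitone w.toFun) (S : RINorm)
    (hbdd : ∃ C : ℝ≥0, ∀ m : ℕ, ratio w S m ≤ C) (hs : ∀ K : ℝ≥0, ∃ m, K < w.primitive m) :
    ¬ IsReflexive 𝕜 (B0Space 𝕜 w S) := by
  intro hR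
  have hx : ∀ k : ℕ, ∃ x : B0Space 𝕜 w S,
      (∀ n < k, BSpace.seq (x : BSpace 𝕜 w S) n = 0) ∧ ‖x‖ ≤ 2 ∧
      ∃ M, ∀ N ≥ M, 1 / 2 ≤
        ‖functionalT 𝕜 w (Finset.range N) ∅ (BSpace.seq (x : BSpace 𝕜 w S))‖ := fun k => by
    -- The block must be so long that the first `k` weights amount to at most half of `w.primitive
    -- m`; shifting it by `k` then loses at most half of its mass.
    obtain ⟨m₀, hm₀⟩ := hs (2 * w.primitive k)
    obtain ⟨m, hm, hr⟩ := exists_ratio_le_two_mul w S hbdd m₀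
    have hms : 2 * w.primitive k ≤ w.primitive m := hm₀.le.trans (w.primitive_mono hm.le)
    have hm0 : 0 < w.primitive m := w.primitive_pos (by omega)
    set E := Finset.Ico k (k + m) with hE
    have hcard : E.card = m := by simp [hE]
    have hsum : w.primitive m ≤ 2 * ∑ n ∈ E, w.toFun n := by
      have h1 : w.primitive k + ∑ n ∈ E, w.toFun n = w.primitive (k + m) :=
        Finset.sum_range_add_sum_Ico _ (Nat.le_add_right k m)
      have h2 : w.primitive m ≤ w.primitive (k + m) := w.primitive_mono (Nat.le_add_left m k)
      rw [← h1] at h2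
      rw [← NNReal.coe_le_coe] at *
      push_cast at *
      linarith
    -- The near-maximality of the ratio at `m` controls the sets larger than `E`, at the cost of the
    -- factor `2`.
    have hind : gauge 𝕜 w S (Set.indicator (E : Set ℕ) 1) ≤ 2 * w.primitive m := by
      refine gauge_indicator_le w hw S _ _ fun j hj => ?_
      rw [hcard] at hj ⊢
      rw [← ratio_mul_fundamental w S m, ← mul_assoc]
      gcongr
      exact hr j hj
    have hgauge : gauge 𝕜 w S ((((w.primitive m : ℝ≥0) : ℝ) : 𝕜)⁻¹ •
        Set.indicator (E : Set ℕ) 1) ≤ (2 : ℝ≥0) := by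
      have hn : ‖((((w.primitive m : ℝ≥0) : ℝ) : 𝕜)⁻¹)‖ₑ = (w.primitive m : ℝ≥0∞)⁻¹ := by
        rw [enorm_inv (by exact_mod_cast hm0.ne')]
        congr 1
        rw [enorm_eq_nnnorm, ENNReal.coe_inj]
        ext
        simp
      rw [gauge_smul, hn]
      calc (w.primitive m : ℝ≥0∞)⁻¹ * gauge 𝕜 w S (Set.indicator (E : Set ℕ) 1)
          ≤ (w.primitive m : ℝ≥0∞)⁻¹ * (2 * w.primitive m) := by gcongr
        _ = 2 * ((w.primitive m : ℝ≥0∞)⁻¹ * w.primitive m) := by ring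
        _ = (2 : ℝ≥0) := by
          rw [ENNReal.inv_mul_cancel (by exact_mod_cast hm0.ne') ENNReal.coe_ne_top]
          simp
    obtain ⟨x, hxs, hxb⟩ := exists_B0Space_of_gauge_le w S _
      (E.finite_toSet.subset ((Function.support_const_smul_subset _ _).trans
        Set.support_indicator_subset)) 2 hgauge
    -- From `N = k + m` on the partial sum sees the whole block, so the lower bound passes to the
    -- limit functional.
    refine ⟨x, fun n hn => ?_, by simpa using hxb, k + m, fun N hN => ?_⟩
    · have : n ∉ E := by simp [hE]; omega
      simp [hxs, this]
    · have hsub : (Finset.range N \ ∅) ∩ E = E := by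
        rw [Finset.sdiff_empty, Finset.inter_eq_right]
        intro n hn
        simp [hE] at hn ⊢
        omega
      have h0 : (0 : ℝ) < w.primitive m := hm0
      rw [hxs, functionalT_smul, functionalT_indicator, hsub, norm_mul, norm_inv,
        RCLike.norm_of_nonneg (NNReal.coe_nonneg _), RCLike.norm_of_nonneg (NNReal.coe_nonneg _),
        inv_mul_eq_div, div_le_div_iff₀ two_pos h0]
      have : (w.primitive m : ℝ) ≤ 2 * (∑ n ∈ E, w.toFun n : ℝ≥0) := by exact_mod_cast hsum
      linarith
  choose x hx0 hxb hxT using hx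
  obtain ⟨g, hg⟩ := hR.exists_weak_limit (Filter.hyperfilter ℕ) x 2 hxb
  obtain ⟨T, hT⟩ := exists_weight_functional 𝕜 w S (Filter.hyperfilter ℕ)
  have hTx : ∀ k, 1 / 2 ≤ ‖T (x k)‖ := fun k => by
    obtain ⟨M, hM⟩ := hxT k
    exact ge_of_tendsto (hT (x k)).norm (Filter.Eventually.filter_mono
      Nat.hyperfilter_le_atTop ((Filter.eventually_ge_atTop M).mono hM))
  -- Weak convergence tested on `T` keeps `g` away from `0`; tested on the coordinates it forces `g
  -- = 0`.
  have hTg : 1 / 2 ≤ ‖T g‖ := ge_of_tendsto' (hg T).norm hTx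
  have hg0 : g = 0 := by
    refine Subtype.ext (Subtype.ext (funext fun n => ?_))
    obtain ⟨φ, hφ⟩ := exists_coord_functional 𝕜 w S n
    have h2 : Filter.Tendsto (fun k => φ (x k)) (Filter.hyperfilter ℕ : Filter ℕ) (𝓝 0) := by
      refine tendsto_const_nhds.congr' (Filter.Eventually.filter_mono
        Nat.hyperfilter_le_atTop ?_)
      filter_upwards [Filter.eventually_gt_atTop n] with k hk
      rw [hφ, hx0 k n hk]
    exact (hφ g).symm.trans (tendsto_nhds_unique (hg φ) h2)
  rw [hg0, map_zero, norm_zero] at hTg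
  norm_num at hTg

end

end CondBasis

theorem mainTheorem7 (𝕜 : Type) [RCLike 𝕜] (w : CondBasis.Weight) (hw : Antitone w.toFun)
    (S : CondBasis.RINorm) (hbdd : ∃ C : NNReal, ∀ m : ℕ, CondBasis.ratio w S m ≤ C) :
    ¬ CondBasis.IsReflexive 𝕜 (CondBasis.B0Space 𝕜 w S) := by
  by_cases hs : ∃ K : ℝ≥0, ∀ m, w.primitive m ≤ K
  · obtain ⟨K, hK⟩ := hs
    exact CondBasis.not_isReflexive_of_primitive_bounded w hw S K hK
  · push Not at hs
    exact CondBasis.not_isReflexive_of_primitive_unbounded w hw S hbdd hs
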